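/- Let $g:(0,\infty)^n\to\mathbb R$ be continuous and symmetric, and let $h:\mathbb R^n\to\mathbb R$, $h(x_1,\dots,x_n)=g(e^{x_1},\dots,e^{x_n})$. For $x\in\mathbb R^n$ let $x^{\downarrow}$ be the vector obtained by rearranging the components of $x$ in decreasing order, let $$D=\Big\{\big(x^{\downarrow}_1,\;x^{\downarrow}_1+x^{\downarrow}_2,\;\dots,\;\textstyle\sum_{i=1}^n x^{\downarrow}_i\big):x\in\mathbb R^n\Big\},$$ and let $p$ be the function on $D$ determined by $$p\big(x^{\downarrow}_1,\;x^{\downarrow}_1+x^{\downarrow}_2,\;\dots,\;\textstyle\sum_{i=1}^n x^{\downarrow}_i\big)=h(x_1,\dots,x_n)\qquad(x\in\mathbb R^n).$$ Suppose that (a) $h$ is convex, and (b) $p$ is nonincreasing in each argument (i.e. $p(y')\le p(y)$ whenever $y,y'\in D$ differ in one coordinate only and that coordinate is larger in $y'$). Let $GL(n,\mathbb R)^+$ be the group of real $n\times n$ matrices with positive determinant and define $$w:GL(n,\mathbb R)^+\to\mathbb R,\qquad w(F)=g(\sigma(F)),$$ where $\sigma(F)$ is the vector of singular values of $F$. Let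 $\Omega\subset\mathbb R^n$ be a bounded open set, and let $\varphi_k:\Omega\to\mathbb R^n$ $(k\in\mathbb N)$ be Lipschitz with a Lipschitz constant independent of $k$, such that $D\varphi_k(x)\in GL(n,\mathbb R)^+$ for almost every $x\in\Omega$ and every $k$, and such that $\varphi_k$ converges uniformly on $\Omega$ to a bi-Lipschitz map $u:\Omega\to\mathbb R^n$. Then $Du(x)\in GL(n,\mathbb R)^+$ for almost every $x\in\Omega$, the function $w(Du)$ is integrable on $\Omega$, each integral $\int_\Omega w(D\varphi_k)\,dx$ is well defined in $(-\infty,+\infty]$ (the integrand is measurable and its negative part is integrable), and $$\liminf_{k\to\infty}\int_\Omega w(D\varphi_k(x))\,dx\;\ge\;\int_\Omega w(Du(x))\,dx .$$ -/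

import Mathlib

open MeasureTheory Filter Topology
open scoped NNReal ENNReal

namespace GLLsc

/-- The rearrangement `x↓` of the components of `x` in decreasing order. -/
noncomputable def decreasingRearrangement {n : ℕ} (x : Fin n → ℝ) : Fin n → ℝ :=
  fun i => x (Tuple.sort x (Fin.rev i))

/-- The vector of partial sums `(x↓₁, x↓₁ + x↓₂, …, x↓₁ + ⋯ + x↓ₙ)`. -/
noncomputable def decreasingPartialSums {n : ℕ} (x : Fin n → ℝ) : Fin n → ℝ :=
  fun k => ∑ i ∈ Finset.Iic k, decreasingRearrangement x i

/-- `p` is associated to the function `h`: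
`p (x↓₁, x↓₁ + x↓₂, …, x↓₁ + ⋯ + x↓ₙ) = h (x₁, …, xₙ)` for all `x`.
For symmetric `h`, this determines `p` exactly on the set of all vectors of such partial sums. -/
def IsAssociated {n : ℕ} (p h : (Fin n → ℝ) → ℝ) : Prop :=
  ∀ x, p (decreasingPartialSums x) = h x

/-- On the set `D`, the function `p` is nonincreasing in each of its arguments separately. -/
def NonincreasingInEachArgumentOn {n : ℕ} (p : (Fin n → ℝ) → ℝ) (D : Set (Fin n → ℝ)) : Prop :=
  ∀ y ∈ D, ∀ (k : Fin n) (t : ℝ), y k ≤ t → Function.update y k t ∈ D →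
    p (Function.update y k t) ≤ p y

/-- `w(F) = g(σ(F))`, where `σ(F)` is the vector of the singular values of `F`. -/
noncomputable def isotropicPotential {n : ℕ} (g : (Fin n → ℝ) → ℝ)
    (F : EuclideanSpace ℝ (Fin n) →L[ℝ] EuclideanSpace ℝ (Fin n)) : ℝ :=
  g (fun i => F.toLinearMap.singularValues i)

/-- The group `GL(n, ℝ)⁺` of linear maps with positive determinant, as a set of linear maps. -/
def glPos (n : ℕ) : Set (EuclideanSpace ℝ (Fin n) →L[ℝ] EuclideanSpace ℝ (Fin n)) :=
  {F | 0 < F.det}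

/-- `u` is bi-Lipschitz on `Ω` (a bi-Lipschitz bijection of `Ω` onto its image). -/
def IsBiLipschitzOn {n : ℕ} (u : EuclideanSpace ℝ (Fin n) → EuclideanSpace ℝ (Fin n))
    (Ω : Set (EuclideanSpace ℝ (Fin n))) : Prop :=
  (∃ K : ℝ≥0, LipschitzOnWith K u Ω) ∧
    ∃ K : ℝ≥0, ∀ x ∈ Ω, ∀ y ∈ Ω, dist x y ≤ K * dist (u x) (u y)

/-- The extended-real integral `∫ f⁺ - ∫ f⁻`. It is the integral of `f` with values in
`(-∞, +∞]` when `f` is a.e. measurable and `∫ f⁻ < ∞`. -/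
noncomputable def extIntegral {α : Type*} [MeasurableSpace α] (μ : Measure α) (f : α → ℝ) :
    EReal :=
  ((∫⁻ x, ENNReal.ofReal (f x) ∂μ : ℝ≥0∞) : EReal) -
    ((∫⁻ x, ENNReal.ofReal (-f x) ∂μ : ℝ≥0∞) : EReal)

end GLLsc

/-!
If a strictly decreasing `x` has larger partial sums than `c`, then moving from `x` further away
from `c` increases them again, so `h` does not increase there and convexity gives `h x ≤ h c`.
Comparing `x` in decreasing with `c` in increasing order shows that `h` is a nonincreasing convex
function of `x₁ + ⋯ + xₙ`; hence `w F = G (det F)` with `G` convex on `(0, ∞)`.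

The Jacobian determinants of uniformly Lipschitz maps converge weakly-* when the maps converge
pointwise: by polarizing the volume preservation of `id + εF` for compactly supported `F`, the
Jacobian integrates to zero as soon as one component has compact support, so one may integrate by
parts and replace the components of `u` by those of `φ_k` one at a time.

Finally `det Du` stays in a compact subset of `(0, ∞)`, so the supporting lines of `G` at `det Du`
have bounded slopes, and integrating them against the weak limit gives the lower semicontinuity.
-/

namespace GLLsc

open scoped ContDiff Manifold

section PartialSums

variable {n : ℕ}

lemma eq_of_sum_Iic_eq {x y : Fin n → ℝ}
    (h : ∀ k, ∑ i ∈ Finset.Iic k, x i = ∑ i ∈ Finset.Iic k, y i) : x = y := by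
  ext k
  induction k using WellFoundedLT.induction with
  | ind k ih =>
    have hk := h k
    rw [← Finset.Iio_insert, Finset.sum_insert (by simp), Finset.sum_insert (by simp),
      Finset.sum_congr rfl fun i hi => ih i (Finset.mem_Iio.mp hi)] at hk
    linarith

/-- The partial sums `(x₁, x₁ + x₂, …, x₁ + ⋯ + xₙ)`, without rearrangement, as a linear
automorphism of `ℝⁿ`. -/
noncomputable def partialSums (n : ℕ) : (Fin n → ℝ) ≃L[ℝ] (Fin n → ℝ) :=
  (LinearEquiv.ofInjectiveEndo (LinearMap.pi fun k => ∑ i ∈ Finset.Iic k, LinearMap.proj i)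
    fun x y hxy => eq_of_sum_Iic_eq fun k => by
      simpa using congrFun hxy k).toContinuousLinearEquiv

lemma partialSums_apply (x : Fin n → ℝ) (k : Fin n) :
    partialSums n x k = ∑ i ∈ Finset.Iic k, x i := by
  change (∑ i ∈ Finset.Iic k, (LinearMap.proj i : (Fin n → ℝ) →ₗ[ℝ] ℝ)) x = _
  simp

lemma decreasingRearrangement_of_antitone {x : Fin n → ℝ} (hx : Antitone x) :
    decreasingRearrangement x = x := by
  have hrev : Monotone (x ∘ (Fin.revPerm : Equiv.Perm (Fin n))) :=
    fun i j hij => hx (Fin.rev_le_rev.mpr hij)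
  ext i
  simpa [decreasingRearrangement] using
    congrFun (Tuple.unique_monotone (Tuple.monotone_sort x) hrev) (Fin.rev i)

lemma decreasingPartialSums_of_antitone {x : Fin n → ℝ} (hx : Antitone x) :
    decreasingPartialSums x = partialSums n x := by
  ext k
  rw [decreasingPartialSums, decreasingRearrangement_of_antitone hx, partialSums_apply]

lemma decreasingPartialSums_comp_perm (x : Fin n → ℝ) (π : Equiv.Perm (Fin n)) :
    decreasingPartialSums (x ∘ π) = decreasingPartialSums x := by
  have h : decreasingRearrangement (x ∘ π) = decreasingRearrangement x :=
    funext fun i => congrFun (Tuple.comp_perm_comp_sort_eq_comp_sort (f := x) (σ := π)) (Fin.rev i)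
  unfold decreasingPartialSums
  rw [h]

lemma IsAssociated.comp_perm {p h : (Fin n → ℝ) → ℝ} (hp : IsAssociated p h) (x : Fin n → ℝ)
    (π : Equiv.Perm (Fin n)) : h (x ∘ π) = h x := by
  rw [← hp, decreasingPartialSums_comp_perm, hp]

lemma isOpen_setOf_strictAnti : IsOpen {x : Fin n → ℝ | StrictAnti x} := by
  simp only [StrictAnti, Set.ofPred_forall]
  refine isOpen_iInter_of_finite fun i => isOpen_iInter_of_finite fun j =>
    isOpen_iInter_of_finite fun _ => isOpen_lt (continuous_apply j) (continuous_apply i)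

lemma range_decreasingPartialSums_mem_nhds {x : Fin n → ℝ} (hx : StrictAnti x) :
    Set.range decreasingPartialSums ∈ 𝓝 (partialSums n x) := by
  refine mem_of_superset
    ((partialSums n).toHomeomorph.isOpenMap.image_mem_nhds (isOpen_setOf_strictAnti.mem_nhds hx)) ?_
  rintro _ ⟨y, hy, rfl⟩
  exact ⟨y, decreasingPartialSums_of_antitone hy.antitone⟩

lemma NonincreasingInEachArgumentOn.eventually_add_smul_le {p : (Fin n → ℝ) → ℝ}
    {D : Set (Fin n → ℝ)} (hp : NonincreasingInEachArgumentOn p D) {y a : Fin n → ℝ}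
    (hD : D ∈ 𝓝 y) (ha : 0 ≤ a) : ∀ᶠ t in 𝓝[>] (0 : ℝ), p (y + t • a) ≤ p y := by
  have hmem : ∀ᶠ t in 𝓝[>] (0 : ℝ), ∀ S : Finset (Fin n), S.piecewise (y + t • a) y ∈ D := by
    refine (eventually_all.mpr fun S => ?_).filter_mono nhdsWithin_le_nhds
    have hcont : Continuous fun t : ℝ => S.piecewise (y + t • a) y := by
      refine continuous_pi fun i => ?_
      by_cases hi : i ∈ S
      · simpa [hi] using by fun_prop
      · simpa [hi] using continuous_const
    have hlim := hcont.tendsto 0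
    simp only [zero_smul, add_zero, Finset.piecewise_same] at hlim
    exact hlim hD
  filter_upwards [hmem, self_mem_nhdsWithin] with t ht hpos
  suffices h : ∀ S : Finset (Fin n), p (S.piecewise (y + t • a) y) ≤ p y by
    simpa using h Finset.univ
  intro S
  induction S using Finset.induction_on with
  | empty => simp
  | insert k S hk ih =>
    have hins := ht (insert k S)
    rw [Finset.piecewise_insert] at hins ⊢
    refine (hp _ (ht S) k _ ?_ hins).trans ih
    simpa [hk] using mul_nonneg (Set.mem_Ioi.mp hpos).le (ha k)

end PartialSums

section Majorization

variable {n : ℕ} {p h : (Fin n → ℝ) → ℝ}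

lemma le_of_strictAnti_of_partialSums_le (hconv : ConvexOn ℝ Set.univ h) (hp : IsAssociated p h)
    (hmono : NonincreasingInEachArgumentOn p (Set.range decreasingPartialSums))
    {x c : Fin n → ℝ} (hx : StrictAnti x) (hc : partialSums n c ≤ partialSums n x) :
    h x ≤ h c := by
  have hstrict : ∀ᶠ t in 𝓝[>] (0 : ℝ), StrictAnti (x + t • (x - c)) := by
    have hcont : Continuous fun t : ℝ => x + t • (x - c) := by fun_prop
    refine (hcont.tendsto' 0 x (by simp)).eventually ?_ |>.filter_mono nhdsWithin_le_nhds
    exact isOpen_setOf_strictAnti.mem_nhds hx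
  have hdecr := hmono.eventually_add_smul_le (range_decreasingPartialSums_mem_nhds hx)
    (sub_nonneg.mpr hc)
  obtain ⟨t, ht_anti, ht_le, ht_pos⟩ := (hstrict.and (hdecr.and self_mem_nhdsWithin)).exists
  have hle : h (x + t • (x - c)) ≤ h x := by
    rw [← hp, ← hp x, decreasingPartialSums_of_antitone ht_anti.antitone,
      decreasingPartialSums_of_antitone hx.antitone]
    simpa using ht_le
  have hseg : x ∈ openSegment ℝ c (x + t • (x - c)) := by
    refine ⟨t / (1 + t), 1 / (1 + t), by positivity, by positivity, by field_simp; ring, ?_⟩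
    ext i
    simp only [Pi.add_apply, Pi.smul_apply, Pi.sub_apply, smul_eq_mul]
    field_simp
    ring
  exact hconv.le_left_of_right_le (Set.mem_univ _) (Set.mem_univ _) hseg hle

lemma sum_Iic_nonneg_of_antitone {d : Fin n → ℝ} (hd : Antitone d) (h0 : 0 ≤ ∑ i, d i)
    (k : Fin n) : 0 ≤ ∑ i ∈ Finset.Iic k, d i := by
  rcases le_total 0 (d k) with hk | hk
  · exact Finset.sum_nonneg fun i hi => hk.trans (hd (Finset.mem_Iic.mp hi))
  · have htail : ∑ i ∈ (Finset.Iic k)ᶜ, d i ≤ 0 :=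
      Finset.sum_nonpos fun i hi => (hd (by simpa using hi : k < i).le).trans hk
    linarith [Finset.sum_add_sum_compl (Finset.Iic k) d]

lemma le_of_antitone_of_monotone_of_sum_le (hconv : ConvexOn ℝ Set.univ h)
    (hp : IsAssociated p h)
    (hmono : NonincreasingInEachArgumentOn p (Set.range decreasingPartialSums))
    {x c : Fin n → ℝ} (hx : Antitone x) (hc : Monotone c) (hsum : ∑ i, c i ≤ ∑ i, x i) :
    h x ≤ h c := by
  let ρ : Fin n → ℝ := fun i => n - i
  have hρ_nonneg : ∀ i, 0 ≤ ρ i := fun i => sub_nonneg.mpr (by exact_mod_cast i.2.le)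
  have hρ_anti : StrictAnti ρ := fun i j hij => sub_lt_sub_left (by exact_mod_cast hij) _
  have hlim : Tendsto (fun δ : ℝ => h (x + δ • ρ)) (𝓝[>] 0) (𝓝 (h x)) := by
    have hcont : Continuous h := continuousOn_univ.mp (hconv.continuousOn isOpen_univ)
    have : Continuous fun δ : ℝ => h (x + δ • ρ) := by fun_prop
    exact (this.tendsto' 0 _ (by simp)).mono_left nhdsWithin_le_nhds
  refine le_of_tendsto hlim ?_
  filter_upwards [self_mem_nhdsWithin] with δ (hδ : 0 < δ)
  have hanti : StrictAnti (x + δ • ρ) := fun i j hij =>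
    add_lt_add_of_le_of_lt (hx hij.le) (mul_lt_mul_of_pos_left (hρ_anti hij) hδ)
  refine le_of_strictAnti_of_partialSums_le hconv hp hmono hanti (sub_nonneg.mp fun k => ?_)
  rw [← map_sub, partialSums_apply]
  refine sum_Iic_nonneg_of_antitone (fun i j hij => sub_le_sub (hanti.antitone hij) (hc hij)) ?_ k
  have hρ_sum : 0 ≤ ∑ i, δ * ρ i := Finset.sum_nonneg fun i _ => mul_nonneg hδ.le (hρ_nonneg i)
  simp only [Pi.add_apply, Pi.smul_apply, smul_eq_mul, Finset.sum_sub_distrib,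
    Finset.sum_add_distrib]
  linarith

theorem le_of_sum_le (hconv : ConvexOn ℝ Set.univ h) (hp : IsAssociated p h)
    (hmono : NonincreasingInEachArgumentOn p (Set.range decreasingPartialSums))
    {x c : Fin n → ℝ} (hxc : ∑ i, c i ≤ ∑ i, x i) : h x ≤ h c := by
  let τ : Equiv.Perm (Fin n) := Fin.revPerm.trans (Tuple.sort x)
  have hx : Antitone (x ∘ τ) := fun i j hij => Tuple.monotone_sort x (Fin.rev_le_rev.mpr hij)
  rw [← hp.comp_perm x τ, ← hp.comp_perm c (Tuple.sort c)]
  refine le_of_antitone_of_monotone_of_sum_le hconv hp hmono hx (Tuple.monotone_sort c) ?_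
  simpa only [Function.comp_apply, Equiv.sum_comp] using hxc

lemma exists_eq_comp_sum (hconv : ConvexOn ℝ Set.univ h)
    (hle : ∀ {x c : Fin n → ℝ}, ∑ i, c i ≤ ∑ i, x i → h x ≤ h c) :
    ∃ H : ℝ → ℝ, ConvexOn ℝ Set.univ H ∧ Antitone H ∧ ∀ x, h x = H (∑ i, x i) := by
  let L : ℝ →ₗ[ℝ] Fin n → ℝ := LinearMap.pi fun _ => (n : ℝ)⁻¹ • LinearMap.id
  refine ⟨h ∘ L, by simpa using hconv.comp_linearMap L, fun s t hst => hle ?_, fun x => ?_⟩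
  · exact Finset.sum_le_sum fun i _ => mul_le_mul_of_nonneg_left hst (by positivity)
  · have hsum : ∑ i, L (∑ j, x j) i = ∑ i, x i := by
      rcases n.eq_zero_or_pos with rfl | hn
      · simp
      · have hn' : (n : ℝ) ≠ 0 := Nat.cast_ne_zero.mpr hn.ne'
        simp [L, ← Finset.mul_sum, mul_inv_cancel_left₀ hn']
    exact le_antisymm (hle hsum.le) (hle hsum.ge)

end Majorization

lemma convexOn_comp_log {f : ℝ → ℝ} (hf : ConvexOn ℝ Set.univ f) (hanti : Antitone f) :
    ConvexOn ℝ (Set.Ioi 0) fun t => f (Real.log t) :=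
  ConvexOn.comp_concaveOn (f := Real.log)
    (hf.subset (Set.subset_univ _) (Real.surjOn_log.image_eq_of_mapsTo
      (Set.mapsTo_univ _ _) ▸ convex_univ)) strictConcaveOn_log_Ioi.concaveOn (hanti.antitoneOn _)

section SingularValues

variable {n : ℕ}

lemma prod_singularValues_eq_abs_det
    (F : EuclideanSpace ℝ (Fin n) →L[ℝ] EuclideanSpace ℝ (Fin n)) :
    ∏ i : Fin n, F.toLinearMap.singularValues i = |F.det| := by
  have h := LinearMap.normDet_eq_prod_singularValues F.toLinearMap
  rw [LinearMap.normDet_eq_abs_det, finrank_euclideanSpace, Fintype.card_fin,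
    ← Fin.prod_univ_eq_prod_range (fun i => F.toLinearMap.singularValues i)] at h
  exact h.symm

lemma isotropicPotential_eq_log_det {g : (Fin n → ℝ) → ℝ} {H : ℝ → ℝ}
    (hg : ∀ x : Fin n → ℝ, g (fun i => Real.exp (x i)) = H (∑ i, x i))
    {F : EuclideanSpace ℝ (Fin n) →L[ℝ] EuclideanSpace ℝ (Fin n)} (hF : F ∈ glPos n) :
    isotropicPotential g F = H (Real.log F.det) := by
  have hprod : ∏ i : Fin n, F.toLinearMap.singularValues i = F.det := by
    rw [prod_singularValues_eq_abs_det, abs_of_pos hF]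
  have hne : ∀ i ∈ Finset.univ, F.toLinearMap.singularValues (i : Fin n) ≠ 0 :=
    Finset.prod_ne_zero_iff.mp (hprod ▸ (show 0 < F.det from hF).ne')
  have hexp : ∀ i : Fin n, Real.exp (Real.log (F.toLinearMap.singularValues i)) =
      F.toLinearMap.singularValues i := fun i =>
    Real.exp_log ((LinearMap.singularValues_nonneg _ _).lt_of_ne' (hne i (Finset.mem_univ i)))
  rw [← hprod, Real.log_prod hne, ← hg, isotropicPotential]
  simp only [hexp]

theorem exists_convexOn_isotropicPotential_eq {g h p : (Fin n → ℝ) → ℝ}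
    (hh : ∀ x, h x = g (fun i => Real.exp (x i))) (hconv : ConvexOn ℝ Set.univ h)
    (hp : IsAssociated p h)
    (hmono : NonincreasingInEachArgumentOn p (Set.range decreasingPartialSums)) :
    ∃ G : ℝ → ℝ, ConvexOn ℝ (Set.Ioi 0) G ∧
      ∀ F ∈ glPos n, isotropicPotential g F = G F.det := by
  obtain ⟨H, hH_conv, hH_anti, hH⟩ := exists_eq_comp_sum hconv (le_of_sum_le hconv hp hmono)
  exact ⟨fun t => H (Real.log t), convexOn_comp_log hH_conv hH_anti, fun F hF =>
    isotropicPotential_eq_log_det (fun x => (hh x).symm.trans (hH x)) hF⟩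

end SingularValues

section IdentityPerturbation

variable {E : Type*} [NormedAddCommGroup E] [NormedSpace ℝ E]

lemma bijective_id_add_of_lipschitzWith [CompleteSpace E] {F : E → E} {c : ℝ≥0}
    (hF : LipschitzWith c F) (hc : c < 1) : Function.Bijective fun x => x + F x := by
  have happrox : ApproximatesLinearOn (fun x => x + F x)
      (ContinuousLinearEquiv.refl ℝ E : E →L[ℝ] E) Set.univ c := by
    rw [ApproximatesLinearOn.approximatesLinearOn_iff_lipschitzOnWith]
    have hsub : (fun x => x + F x) - ⇑(ContinuousLinearEquiv.refl ℝ E : E →L[ℝ] E) = F :=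
      funext fun x => add_sub_cancel_left x (F x)
    rw [hsub]
    exact hF.lipschitzOnWith
  refine (happrox.toHomeomorph _ ?_).bijective
  rcases subsingleton_or_nontrivial E with hE | hE
  · exact Or.inl hE
  · have hnorm : ‖((ContinuousLinearEquiv.refl ℝ E).symm : E →L[ℝ] E)‖₊ = 1 :=
      NNReal.coe_injective ContinuousLinearMap.norm_id
    exact Or.inr (by rwa [hnorm, inv_one])

variable [FiniteDimensional ℝ E]

lemma det_id_add_pos {A : E →L[ℝ] E} (hA : ‖A‖ < 1) :
    0 < (ContinuousLinearMap.id ℝ E + A).det := by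
  have : CompleteSpace E := FiniteDimensional.complete ℝ E
  have hne : ∀ t ∈ Set.Icc (0 : ℝ) 1, (ContinuousLinearMap.id ℝ E + t • A).det ≠ 0 := by
    intro t ht
    have hnorm : ‖-(t • A)‖ < 1 := by
      rw [norm_neg, norm_smul, Real.norm_of_nonneg ht.1]
      exact (mul_le_of_le_one_left (norm_nonneg A) ht.2).trans_lt hA
    have hunit := isUnit_one_sub_of_norm_lt_one hnorm
    rw [sub_neg_eq_add] at hunit
    exact ((hunit.map ContinuousLinearMap.toLinearMapRingHom).map LinearMap.det).ne_zero
  by_contra! hneg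
  have hcont : ContinuousOn (fun t : ℝ => (ContinuousLinearMap.id ℝ E + t • A).det)
      (Set.Icc 0 1) :=
    (ContinuousLinearMap.continuous_det.comp (by fun_prop)).continuousOn
  obtain ⟨t, ht, ht0⟩ := intermediate_value_Icc' zero_le_one hcont
    ⟨by simpa using hneg, by simp [ContinuousLinearMap.det]⟩
  exact hne t ht ht0

variable [MeasurableSpace E] [BorelSpace E] (μ : Measure E) [μ.IsAddHaarMeasure]

lemma addHaar_image_eq_zero_of_lipschitzWith {T : E → E} {K : ℝ≥0} (hT : LipschitzWith K T)
    {s : Set E} (hs : μ s = 0) : μ (T '' s) = 0 := by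
  have hle := hT.hausdorffMeasure_image_le (d := (Module.finrank ℝ E : ℝ)) (Nat.cast_nonneg _) s
  rw [Measure.absolutelyContinuous_isAddHaarMeasure _ μ hs, mul_zero] at hle
  exact Measure.absolutelyContinuous_isAddHaarMeasure μ _ (le_antisymm hle zero_le)

lemma setIntegral_abs_det_fderiv_of_injOn {T : E → E} {K : ℝ≥0} (hT : LipschitzWith K T)
    {s : Set E} (hs : MeasurableSet s) (hinj : Set.InjOn T s) :
    ∫ x in s, |(fderiv ℝ T x).det| ∂μ = μ.real (T '' s) := by
  let D := {x : E | DifferentiableAt ℝ T x}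
  have hDs : (s ∩ D : Set E) =ᵐ[μ] s :=
    inter_ae_eq_left_of_ae_eq_univ (eventuallyEq_univ.mpr hT.ae_differentiableAt)
  have himage : μ (T '' (s ∩ D)) = μ (T '' s) := by
    have hnull : μ (T '' (s \ (s ∩ D))) = 0 :=
      addHaar_image_eq_zero_of_lipschitzWith μ hT (ae_eq_set.mp hDs).2
    rw [← measure_congr (union_ae_eq_left_of_ae_eq_empty (ae_eq_empty.mpr hnull)),
      ← Set.image_union, Set.union_sdiff_cancel Set.inter_subset_left]
  have hchange := integral_image_eq_integral_abs_det_fderiv_smul μ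
    (hs.inter (measurableSet_of_differentiableAt ℝ T))
    (fun x hx => hx.2.hasFDerivAt.hasFDerivWithinAt) (hinj.mono Set.inter_subset_left)
    fun _ => (1 : ℝ)
  rw [setIntegral_congr_set hDs] at hchange
  rw [measureReal_def, ← himage]
  simpa [measureReal_def] using hchange.symm

theorem setIntegral_det_fderiv_id_add {F : E → E} {c : ℝ≥0} (hF : LipschitzWith c F) (hc : c < 1)
    {s : Set E} (hs : MeasurableSet s) (hFs : ∀ x ∉ s, F x = 0) :
    ∫ x in s, (fderiv ℝ (fun y => y + F y) x).det ∂μ = μ.real s := by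
  have : CompleteSpace E := FiniteDimensional.complete ℝ E
  have hbij := bijective_id_add_of_lipschitzWith hF hc
  have himage : (fun x => x + F x) '' s = s := by
    have hcompl : (fun x => x + F x) '' sᶜ = sᶜ :=
      (Set.image_congr fun x hx => by rw [hFs x hx, add_zero]).trans (Set.image_id' _)
    rw [Set.image_compl_eq hbij] at hcompl
    exact compl_injective hcompl
  have hvol := setIntegral_abs_det_fderiv_of_injOn μ (LipschitzWith.id.add hF) hs
    hbij.injective.injOn
  simp only [id_eq, himage] at hvol
  rw [← hvol]
  refine setIntegral_congr_ae hs ?_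
  filter_upwards [hF.ae_differentiableAt (μ := μ)] with x hx _
  have hpos : 0 < (ContinuousLinearMap.id ℝ E + fderiv ℝ F x).det :=
    det_id_add_pos ((norm_fderiv_le_of_lipschitz ℝ hF).trans_lt (by exact_mod_cast hc))
  have hfderiv : fderiv ℝ (fun y => y + F y) x = ContinuousLinearMap.id ℝ E + fderiv ℝ F x :=
    ((hasFDerivAt_id x).add hx.hasFDerivAt).fderiv
  rw [hfderiv, abs_of_pos hpos]

end IdentityPerturbation

section Jacobian

variable {ι : Type*} [Fintype ι]

/-- The row `(∂₁f(x), …, ∂ₙf(x))` of partial derivatives of a scalar function. -/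
noncomputable def partialDerivs [DecidableEq ι] (f : EuclideanSpace ℝ ι → ℝ)
    (x : EuclideanSpace ℝ ι) : ι → ℝ :=
  fun j => fderiv ℝ f x (EuclideanSpace.single j 1)

/-- The Jacobian determinant `det (∂ⱼfᵢ(x))` of a family of scalar functions, kept as a value of
the alternating map `Matrix.detRowAlternating` so that its multilinearity in the `fᵢ` is at hand. -/
noncomputable def jacobian [DecidableEq ι] (f : ι → EuclideanSpace ℝ ι → ℝ)
    (x : EuclideanSpace ℝ ι) : ℝ :=
  Matrix.detRowAlternating (R := ℝ) fun i => partialDerivs (f i) x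

lemma lipschitzWith_proj (i : ι) : LipschitzWith 1 fun x : EuclideanSpace ℝ ι => x i :=
  LipschitzWith.of_dist_le_mul fun x y => by
    simpa [dist_eq_norm] using PiLp.norm_apply_le (x - y) i

lemma lipschitzWith_update [DecidableEq ι] {f : ι → EuclideanSpace ℝ ι → ℝ} {K : ι → ℝ≥0}
    (hf : ∀ j, LipschitzWith (K j) (f j)) (i : ι) {w : EuclideanSpace ℝ ι → ℝ} {L : ℝ≥0}
    (hw : LipschitzWith L w) (j : ι) :
    LipschitzWith (Function.update K i L j) (Function.update f i w j) := by
  rcases eq_or_ne j i with rfl | hj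
  · simpa only [Function.update_self] using hw
  · simpa only [Function.update_of_ne hj] using hf j

variable [DecidableEq ι] {f g : ι → EuclideanSpace ℝ ι → ℝ} {K : ι → ℝ≥0}
  {x : EuclideanSpace ℝ ι}

lemma measurable_jacobian (f : ι → EuclideanSpace ℝ ι → ℝ) : Measurable (jacobian f) := by
  have hdet : jacobian f = fun x => ∑ σ : Equiv.Perm ι, ((Equiv.Perm.sign σ : ℤ) : ℝ) *
      ∏ i, partialDerivs (f (σ i)) x i :=
    funext fun x => Matrix.det_apply' _
  rw [hdet]
  exact Finset.measurable_sum _ fun σ _ => (Finset.measurable_prod _ fun i _ =>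
    measurable_fderiv_apply_const ℝ _ _).const_mul _

lemma abs_jacobian_le (hf : ∀ i, LipschitzWith (K i) (f i)) (x : EuclideanSpace ℝ ι) :
    |jacobian f x| ≤ (Fintype.card ι).factorial * ∏ i, (K i : ℝ) := by
  have hentry : ∀ i j, |partialDerivs (f i) x j| ≤ K i := fun i j => by
    have h := (fderiv ℝ (f i) x).le_opNorm (EuclideanSpace.single j 1)
    rw [PiLp.norm_single, norm_one, mul_one] at h
    exact h.trans (norm_fderiv_le_of_lipschitz ℝ (hf i))
  calc |jacobian f x| ≤ ∑ σ : Equiv.Perm ι, ∏ i, (K (σ i) : ℝ) := by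
        rw [show jacobian f x = _ from Matrix.det_apply' _]
        refine Finset.abs_sum_le_sum_abs _ _ |>.trans (Finset.sum_le_sum fun σ _ => ?_)
        rw [abs_mul, abs_unit_intCast, one_mul, Finset.abs_prod]
        exact Finset.prod_le_prod (fun _ _ => abs_nonneg _) fun i _ => hentry (σ i) i
    _ = (Fintype.card ι).factorial * ∏ i, (K i : ℝ) := by
        simp_rw [Equiv.prod_comp _ fun i => (K i : ℝ)]
        rw [Finset.sum_const, Finset.card_univ, Fintype.card_perm, nsmul_eq_mul]

lemma jacobian_congr_of_eventuallyEq (h : ∀ i, f i =ᶠ[𝓝 x] g i) : jacobian f x = jacobian g x :=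
  congrArg _ (funext fun i => funext fun _ => DFunLike.congr_fun (h i).fderiv_eq _)

lemma jacobian_eq_zero_of_notMem_tsupport {i : ι} (hx : x ∉ tsupport (f i)) :
    jacobian f x = 0 := by
  refine (Matrix.detRowAlternating (R := ℝ)).map_coord_zero i (funext fun j => ?_)
  simp [partialDerivs, (notMem_tsupport_iff_eventuallyEq.mp hx).fderiv_eq]

lemma jacobian_update (f : ι → EuclideanSpace ℝ ι → ℝ) (i : ι) (w : EuclideanSpace ℝ ι → ℝ)
    (x : EuclideanSpace ℝ ι) : jacobian (Function.update f i w) x =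
      Matrix.detRowAlternating (R := ℝ)
        (Function.update (fun j => partialDerivs (f j) x) i (partialDerivs w x)) := by
  refine congrArg _ (funext fun j => ?_)
  exact Function.apply_update (fun _ v => partialDerivs v x) f i w j

lemma jacobian_update_sub {i : ι} {v w : EuclideanSpace ℝ ι → ℝ}
    (hv : DifferentiableAt ℝ v x) (hw : DifferentiableAt ℝ w x) :
    jacobian (Function.update f i fun y => v y - w y) x =
      jacobian (Function.update f i v) x - jacobian (Function.update f i w) x := by
  have hsub : partialDerivs (fun y => v y - w y) x = partialDerivs v x - partialDerivs w x :=
    funext fun j => by simp [partialDerivs, fderiv_fun_sub hv hw]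
  rw [jacobian_update, hsub, AlternatingMap.map_update_sub, ← jacobian_update, ← jacobian_update]

lemma jacobian_update_mul {i : ι} {v w : EuclideanSpace ℝ ι → ℝ}
    (hv : DifferentiableAt ℝ v x) (hw : DifferentiableAt ℝ w x) :
    jacobian (Function.update f i fun y => v y * w y) x =
      v x * jacobian (Function.update f i w) x + w x * jacobian (Function.update f i v) x := by
  have hmul : partialDerivs (fun y => v y * w y) x =
      v x • partialDerivs w x + w x • partialDerivs v x :=
    funext fun j => by simp [partialDerivs, fderiv_fun_mul hv hw]
  rw [jacobian_update, hmul, AlternatingMap.map_update_add, AlternatingMap.map_update_smul,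
    AlternatingMap.map_update_smul, ← jacobian_update, ← jacobian_update, smul_eq_mul, smul_eq_mul]

lemma jacobian_const_mul (c : ℝ) (f : ι → EuclideanSpace ℝ ι → ℝ) (x : EuclideanSpace ℝ ι) :
    jacobian (fun i y => c * f i y) x = c ^ Fintype.card ι * jacobian f x := by
  have hsmul : ∀ i, partialDerivs (fun y => c * f i y) x = c • partialDerivs (f i) x := fun i =>
    funext fun _ => DFunLike.congr_fun (congrFun (fderiv_const_smul_field c) x) _
  simp only [jacobian, hsmul]
  rw [← AlternatingMap.coe_multilinearMap, MultilinearMap.map_smul_univ, Finset.prod_const,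
    Finset.card_univ, smul_eq_mul]

lemma det_fderiv_eq_jacobian {F : EuclideanSpace ℝ ι → EuclideanSpace ℝ ι}
    (hF : DifferentiableAt ℝ F x) : (fderiv ℝ F x).det = jacobian (fun i y => F y i) x := by
  rw [ContinuousLinearMap.det,
    ← LinearMap.det_toMatrix (EuclideanSpace.basisFun ι ℝ).toBasis (fderiv ℝ F x).toLinearMap]
  refine congrArg Matrix.det (Matrix.ext fun i j => ?_)
  have hcoord : HasFDerivAt (fun y => F y i) ((EuclideanSpace.proj i).comp (fderiv ℝ F x)) x :=
    (EuclideanSpace.proj (𝕜 := ℝ) i).hasFDerivAt.comp x hF.hasFDerivAt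
  simp [LinearMap.toMatrix_apply, partialDerivs, hcoord.fderiv]

lemma integrable_mul_jacobian {μ : Measure (EuclideanSpace ℝ ι)}
    (hf : ∀ i, LipschitzWith (K i) (f i)) {ψ : EuclideanSpace ℝ ι → ℝ} (hψ : Integrable ψ μ) :
    Integrable (fun x => ψ x * jacobian f x) μ :=
  hψ.mul_bdd (measurable_jacobian f).aestronglyMeasurable (ae_of_all _ (abs_jacobian_le hf))

end Jacobian

section NullLagrangian

lemma map_eq_sum_neg_one_pow_smul_piecewise {R ι N : Type*} {M : ι → Type*} [CommRing R]
    [∀ i, AddCommGroup (M i)] [∀ i, Module R (M i)] [AddCommGroup N] [Module R N] [Fintype ι]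
    [DecidableEq ι] (D : MultilinearMap R M N) (e v : ∀ i, M i) :
    D v = ∑ S : Finset ι, (-1 : R) ^ S.card • D (S.piecewise e (e + v)) := by
  calc D v = D (-e + (e + v)) := by rw [neg_add_cancel_left]
    _ = ∑ S : Finset ι, D (S.piecewise (-e) (e + v)) := D.map_add_univ _ _
    _ = ∑ S : Finset ι, (-1 : R) ^ S.card • D (S.piecewise e (e + v)) := by
        refine Finset.sum_congr rfl fun S _ => ?_
        rw [← Finset.prod_const, ← D.map_piecewise_smul]
        refine congrArg D (funext fun i => ?_)
        by_cases hi : i ∈ S <;> simp [hi]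

variable {ι : Type*} [Fintype ι] [DecidableEq ι] {f : ι → EuclideanSpace ℝ ι → ℝ}

lemma jacobian_eq_sum_neg_one_pow_mul {x : EuclideanSpace ℝ ι}
    (hf : ∀ i, DifferentiableAt ℝ (f i) x) :
    jacobian f x = ∑ S : Finset ι, (-1) ^ S.card *
      jacobian (fun i y => y i + (S : Set ι)ᶜ.indicator f i y) x := by
  have hproj : ∀ i, HasFDerivAt (fun y : EuclideanSpace ℝ ι => y i)
      (EuclideanSpace.proj i : EuclideanSpace ℝ ι →L[ℝ] ℝ) x :=
    fun i => (EuclideanSpace.proj (𝕜 := ℝ) i).hasFDerivAt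
  refine (map_eq_sum_neg_one_pow_smul_piecewise (Matrix.detRowAlternating (R := ℝ)).toMultilinearMap
    (fun i => partialDerivs (fun y => y i) x) fun i => partialDerivs (f i) x).trans
    (Finset.sum_congr rfl fun S _ => ?_)
  refine congrArg _ (congrArg _ (funext fun i => ?_))
  by_cases hi : i ∈ S
  · simp [hi]
  · have hadd : fderiv ℝ (fun y => y i + f i y) x = EuclideanSpace.proj i + fderiv ℝ (f i) x :=
      ((hproj i).add (hf i).hasFDerivAt).fderiv
    ext j
    simp [hi, partialDerivs, hadd, (hproj i).fderiv]

lemma setIntegral_jacobian_add {K : ℝ≥0} (hf : ∀ i, LipschitzWith K (f i))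
    (hK : (Fintype.card ι : ℝ≥0) ^ (1 / (2 : ℝ≥0∞)).toReal * K < 1) {s : Set (EuclideanSpace ℝ ι)}
    (hs : MeasurableSet s) (hfs : ∀ i, ∀ x ∉ s, f i x = 0) :
    ∫ x in s, jacobian (fun i y => y i + f i y) x = volume.real s := by
  let F : EuclideanSpace ℝ ι → EuclideanSpace ℝ ι := fun y => WithLp.toLp 2 fun i => f i y
  have hF : LipschitzWith ((Fintype.card ι : ℝ≥0) ^ (1 / (2 : ℝ≥0∞)).toReal * K) F :=
    (PiLp.lipschitzWith_toLp 2 _).comp (fun x y =>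
      edist_pi_le_iff.mpr fun i => hf i x y)
  rw [← setIntegral_det_fderiv_id_add volume hF hK hs fun x hx => by
    ext i; exact hfs i x hx]
  refine setIntegral_congr_ae hs ?_
  filter_upwards [hF.ae_differentiableAt] with x hx _
  exact (det_fderiv_eq_jacobian (differentiableAt_id.add hx)).symm

lemma integral_jacobian_eq_zero_of_lipschitzWith_small [Nonempty ι] {K : ℝ≥0}
    (hf : ∀ i, LipschitzWith K (f i))
    (hK : (Fintype.card ι : ℝ≥0) ^ (1 / (2 : ℝ≥0∞)).toReal * K < 1)
    (hfc : ∀ i, HasCompactSupport (f i)) : ∫ x, jacobian f x = 0 := by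
  let s := ⋃ i, tsupport (f i)
  have hs : IsCompact s := isCompact_iUnion fun i => (hfc i).isCompact
  have hfs : ∀ i, ∀ x ∉ s, x ∉ tsupport (f i) := fun i x hx h => hx (Set.mem_iUnion.mpr ⟨i, h⟩)
  have hpiece : ∀ (S : Finset ι) i, LipschitzWith K ((S : Set ι)ᶜ.indicator f i) := fun S i => by
    by_cases hi : i ∈ S
    · simpa [hi, Pi.zero_def] using LipschitzWith.const' (0 : ℝ)
    · simpa [hi] using hf i
  have hvol : ∀ S : Finset ι,
      ∫ x in s, jacobian (fun i y => y i + (S : Set ι)ᶜ.indicator f i y) x = volume.real s :=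
    fun S => setIntegral_jacobian_add (hpiece S) hK hs.measurableSet fun i x hx => by
      by_cases hi : i ∈ S
      · simp [hi]
      · simp [hi, image_eq_zero_of_notMem_tsupport (hfs i x hx)]
  have hint : ∀ S : Finset ι,
      IntegrableOn (jacobian fun i y => y i + (S : Set ι)ᶜ.indicator f i y) s := fun S => by
    simpa only [IntegrableOn, one_mul] using integrable_mul_jacobian
      (fun i => (lipschitzWith_proj i).add (hpiece S i))
      (integrableOn_const hs.measure_lt_top.ne (C := (1 : ℝ)))
  have hsign : ∑ S : Finset ι, (-1 : ℝ) ^ S.card = 0 := by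
    exact_mod_cast Finset.powerset_univ (α := ι) ▸
      Finset.sum_powerset_neg_one_pow_card_of_nonempty Finset.univ_nonempty
  calc ∫ x, jacobian f x = ∫ x in s, jacobian f x :=
        (setIntegral_eq_integral_of_forall_compl_eq_zero fun x hx =>
          jacobian_eq_zero_of_notMem_tsupport (hfs (Classical.arbitrary ι) x hx)).symm
    _ = ∫ x in s, ∑ S : Finset ι, (-1) ^ S.card *
          jacobian (fun i y => y i + (S : Set ι)ᶜ.indicator f i y) x := by
        refine integral_congr_ae (ae_restrict_of_ae ?_)
        filter_upwards [ae_all_iff.mpr fun i => (hf i).ae_differentiableAt] with x hx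
        exact jacobian_eq_sum_neg_one_pow_mul hx
    _ = ∑ S : Finset ι, (-1) ^ S.card * volume.real s := by
        rw [integral_finsetSum _ fun S _ => (hint S).const_mul _]
        simp_rw [integral_const_mul, hvol]
    _ = 0 := by rw [← Finset.sum_mul, hsign, zero_mul]

lemma integral_jacobian_eq_zero_of_forall_hasCompactSupport [Nonempty ι] {K : ι → ℝ≥0}
    (hf : ∀ i, LipschitzWith (K i) (f i)) (hfc : ∀ i, HasCompactSupport (f i)) :
    ∫ x, jacobian f x = 0 := by
  set C : ℝ≥0 := (Fintype.card ι : ℝ≥0) ^ (1 / (2 : ℝ≥0∞)).toReal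
  let L := ∑ i, K i
  let t : ℝ≥0 := (C * L + 1)⁻¹
  have : 0 < t := by positivity
  have hsmall : C * (t * L) < 1 := by
    calc C * (t * L) = (C * L) / (C * L + 1) := by rw [div_eq_inv_mul]; ring
      _ < 1 := (div_lt_one (by positivity)).mpr (lt_add_one _)
  have hscaled : ∀ i, LipschitzWith (t * L) fun y => t * f i y := fun i => by
    have hle : K i ≤ L := Finset.single_le_sum (fun _ _ => zero_le) (Finset.mem_univ i)
    simpa [Function.comp_def] using (lipschitzWith_smul (t : ℝ)).comp ((hf i).weaken hle)
  have hzero := integral_jacobian_eq_zero_of_lipschitzWith_small hscaled hsmall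
    fun i => (hfc i).mul_left
  simp_rw [jacobian_const_mul, integral_const_mul] at hzero
  exact (mul_eq_zero.mp hzero).resolve_left (by positivity)

end NullLagrangian

section IntegrationByParts

lemma exists_contDiff_cutoff {E : Type*} [NormedAddCommGroup E] [NormedSpace ℝ E]
    [FiniteDimensional ℝ E] {s U : Set E} (hs : IsCompact s) (hU : IsOpen U) (hsU : s ⊆ U) :
    ∃ χ : E → ℝ, ContDiff ℝ ∞ χ ∧ HasCompactSupport χ ∧ tsupport χ ⊆ U ∧
      (∀ᶠ x in 𝓝ˢ s, χ x = 1) ∧ ∀ x, χ x ∈ Set.Icc 0 1 := by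
  have : ProperSpace E := FiniteDimensional.proper ℝ E
  obtain ⟨t, ht, hst, htU⟩ := exists_compact_between hs hU hsU
  obtain ⟨χ, hone, hzero, hmem⟩ :=
    exists_contMDiffMap_one_nhds_of_subset_interior 𝓘(ℝ, E) (n := ⊤) hs.isClosed hst
  have hsupport : tsupport χ ⊆ t := closure_minimal
    (fun x hx => by_contra fun hxt => hx (hzero x hxt)) ht.isClosed
  exact ⟨χ, χ.contMDiff.contDiff, ht.of_isClosed_subset (isClosed_tsupport _) hsupport,
    hsupport.trans htU, hone, hmem⟩

lemma exists_lipschitzWith_mul {X : Type*} [PseudoMetricSpace X] {f g : X → ℝ} {Kf Kg : ℝ≥0}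
    (hf : LipschitzWith Kf f) (hfc : HasCompactSupport f) (hg : LipschitzWith Kg g) :
    ∃ K, LipschitzWith K fun x => f x * g x := by
  obtain ⟨M, hM⟩ := hfc.isCompact.exists_bound_of_continuousOn hg.continuous.continuousOn
  obtain ⟨N, hN⟩ := hfc.exists_bound_of_continuous hf.continuous
  have hdist : ∀ x ∈ tsupport f, ∀ y, dist (f x * g x) (f y * g y) ≤
      (Kf * M.toNNReal + N.toNNReal * Kg : ℝ≥0) * dist x y := by
    intro x hx y
    calc dist (f x * g x) (f y * g y) = |(f x - f y) * g x + f y * (g x - g y)| := by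
          rw [Real.dist_eq]; ring_nf
      _ ≤ dist (f x) (f y) * |g x| + |f y| * dist (g x) (g y) := by
          simpa only [abs_mul, Real.dist_eq] using
            abs_add_le ((f x - f y) * g x) (f y * (g x - g y))
      _ ≤ (Kf * dist x y) * M.toNNReal + N.toNNReal * (Kg * dist x y) := by
          gcongr
          · exact hf.dist_le_mul x y
          · exact (hM x hx).trans (Real.le_coe_toNNReal M)
          · exact (hN y).trans (Real.le_coe_toNNReal N)
          · exact hg.dist_le_mul x y
      _ = (Kf * M.toNNReal + N.toNNReal * Kg : ℝ≥0) * dist x y := by push_cast; ring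
  refine ⟨Kf * M.toNNReal + N.toNNReal * Kg, LipschitzWith.of_dist_le_mul fun x y => ?_⟩
  by_cases hx : x ∈ tsupport f
  · exact hdist x hx y
  by_cases hy : y ∈ tsupport f
  · rw [dist_comm, dist_comm x]
    exact hdist y hy x
  · simp only [image_eq_zero_of_notMem_tsupport hx, image_eq_zero_of_notMem_tsupport hy, zero_mul,
      dist_self]
    positivity

variable {ι : Type*} [Fintype ι] [DecidableEq ι] {f : ι → EuclideanSpace ℝ ι → ℝ} {K : ι → ℝ≥0}

theorem integral_jacobian_eq_zero (hf : ∀ i, LipschitzWith (K i) (f i)) (i : ι)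
    (hfc : HasCompactSupport (f i)) : ∫ x, jacobian f x = 0 := by
  obtain ⟨χ, hχ, hχc, -, hχ1, -⟩ :=
    exists_contDiff_cutoff hfc.isCompact isOpen_univ (Set.subset_univ _)
  obtain ⟨L, hL⟩ := hχ.lipschitzWith_of_hasCompactSupport hχc (by simp)
  choose M hM using fun j => exists_lipschitzWith_mul hL hχc (hf j)
  have : Nonempty ι := ⟨i⟩
  rw [← integral_jacobian_eq_zero_of_forall_hasCompactSupport hM fun j => hχc.mul_right]
  refine integral_congr_ae (ae_of_all _ fun x => ?_)
  by_cases hx : x ∈ tsupport (f i)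
  · refine jacobian_congr_of_eventuallyEq fun j => ?_
    filter_upwards [eventually_nhdsSet_iff_forall.mp hχ1 x hx] with y hy
    rw [hy, one_mul]
  · exact (jacobian_eq_zero_of_notMem_tsupport hx).trans
      (jacobian_eq_zero_of_notMem_tsupport fun h => hx (tsupport_mul_subset_right h)).symm

lemma integrable_mul_jacobian_update (hf : ∀ i, LipschitzWith (K i) (f i)) (i : ι)
    {ψ w : EuclideanSpace ℝ ι → ℝ} {L : ℝ≥0} (hψ : LipschitzWith L ψ)
    (hψc : HasCompactSupport ψ) (hw : Continuous w) :
    Integrable fun x => w x * jacobian (Function.update f i ψ) x := by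
  have hupdate := lipschitzWith_update hf i hψ
  refine (integrableOn_iff_integrable_of_support_subset fun x hx => ?_).mp
    (integrable_mul_jacobian hupdate (hw.continuousOn.integrableOn_compact hψc.isCompact))
  by_contra hxψ
  exact hx (mul_eq_zero_of_right _
    (jacobian_eq_zero_of_notMem_tsupport (i := i) (by rwa [Function.update_self])))

theorem integral_mul_jacobian_update (hf : ∀ i, LipschitzWith (K i) (f i)) (i : ι)
    {ψ w : EuclideanSpace ℝ ι → ℝ} {L M : ℝ≥0} (hψ : LipschitzWith L ψ)
    (hψc : HasCompactSupport ψ) (hw : LipschitzWith M w) :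
    ∫ x, ψ x * jacobian (Function.update f i w) x =
      -∫ x, w x * jacobian (Function.update f i ψ) x := by
  obtain ⟨C, hC⟩ := exists_lipschitzWith_mul hψ hψc hw
  rw [eq_neg_iff_add_eq_zero, ← integral_add, ← integral_jacobian_eq_zero
    (lipschitzWith_update hf i hC) i (by rw [Function.update_self]; exact hψc.mul_right)]
  · refine integral_congr_ae ?_
    filter_upwards [hψ.ae_differentiableAt, hw.ae_differentiableAt] with x hx hx'
    exact (jacobian_update_mul hx hx').symm
  · exact integrable_mul_jacobian (lipschitzWith_update hf i hw)
      (hψ.continuous.integrable_of_hasCompactSupport hψc)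
  · exact integrable_mul_jacobian_update hf i hψ hψc hw.continuous

end IntegrationByParts

section WeakContinuity

lemma exists_forall_norm_le_of_tendsto {X F : Type*} [PseudoMetricSpace X]
    [SeminormedAddCommGroup F] {w : ℕ → X → F} {M : ℝ≥0} (hw : ∀ k, LipschitzWith M (w k))
    {s : Set X} (hs : Bornology.IsBounded s) {v : X → F}
    (hlim : ∀ x ∈ s, Tendsto (fun k => w k x) atTop (𝓝 (v x))) :
    ∃ B, ∀ k, ∀ x ∈ s, ‖w k x‖ ≤ B := by
  rcases s.eq_empty_or_nonempty with rfl | ⟨x₀, hx₀⟩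
  · exact ⟨0, by simp⟩
  obtain ⟨R, hR⟩ := hs.subset_closedBall x₀
  obtain ⟨B, hB⟩ := (hlim x₀ hx₀).norm.bddAbove_range
  refine ⟨B + M * R, fun k x hx => ?_⟩
  calc ‖w k x‖ ≤ ‖w k x₀‖ + dist (w k x) (w k x₀) := by
        rw [dist_eq_norm]; exact norm_le_norm_add_norm_sub' _ _
    _ ≤ B + M * R := by
        gcongr
        · exact hB (Set.mem_range_self k)
        · exact ((hw k).dist_le_mul x x₀).trans (by gcongr; exact hR hx)

lemma lipschitzWith_piecewise {ι X : Type*} [DecidableEq ι] [PseudoEMetricSpace X]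
    {K : ι → ℝ≥0} (S : Finset ι) {v u : ι → X → ℝ} (hv : ∀ i, LipschitzWith (K i) (v i))
    (hu : ∀ i, LipschitzWith (K i) (u i)) (i : ι) :
    LipschitzWith (K i) (S.piecewise v u i) := by
  by_cases hi : i ∈ S
  · simpa only [hi, Finset.piecewise_eq_of_mem] using hv i
  · simpa only [hi, not_false_eq_true, Finset.piecewise_eq_of_notMem] using hu i

variable {ι : Type*} [Fintype ι] [DecidableEq ι] {K : ι → ℝ≥0}

lemma tendsto_integral_mul_jacobian_update_zero {f : ℕ → ι → EuclideanSpace ℝ ι → ℝ}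
    (hf : ∀ k i, LipschitzWith (K i) (f k i)) (i : ι) {ψ : EuclideanSpace ℝ ι → ℝ} {L : ℝ≥0}
    (hψ : LipschitzWith L ψ) (hψc : HasCompactSupport ψ) {w : ℕ → EuclideanSpace ℝ ι → ℝ}
    {M : ℝ≥0} (hw : ∀ k, LipschitzWith M (w k))
    (hlim : ∀ x ∈ tsupport ψ, Tendsto (fun k => w k x) atTop (𝓝 0)) :
    Tendsto (fun k => ∫ x, w k x * jacobian (Function.update (f k) i ψ) x) atTop (𝓝 0) := by
  obtain ⟨B, hB⟩ := exists_forall_norm_le_of_tendsto hw hψc.isCompact.isBounded hlim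
  let C := (Fintype.card ι).factorial * ∏ j, (Function.update K i L j : ℝ)
  have hC : ∀ k x, |jacobian (Function.update (f k) i ψ) x| ≤ C := fun k =>
    abs_jacobian_le (lipschitzWith_update (hf k) i hψ)
  have hzero : ∀ k, ∀ x ∉ tsupport ψ, jacobian (Function.update (f k) i ψ) x = 0 := fun k x hx =>
    jacobian_eq_zero_of_notMem_tsupport (i := i) (by rwa [Function.update_self])
  rw [← integral_zero (EuclideanSpace ℝ ι) ℝ]
  refine tendsto_integral_of_dominated_convergence
    ((tsupport ψ).indicator fun _ => B * C) (fun k => ?_) ?_ (fun k => ae_of_all _ fun x => ?_)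
    (ae_of_all _ fun x => ?_)
  · exact ((hw k).continuous.measurable.mul (measurable_jacobian _)).aestronglyMeasurable
  · exact (integrable_indicator_iff hψc.isCompact.measurableSet).mpr
      (integrableOn_const hψc.isCompact.measure_lt_top.ne)
  · by_cases hx : x ∈ tsupport ψ
    · rw [Set.indicator_of_mem hx, norm_mul]
      gcongr
      · exact (norm_nonneg _).trans (hB k x hx)
      · exact hB k x hx
      · exact hC k x
    · simp [hx, hzero k x hx]
  · by_cases hx : x ∈ tsupport ψ
    · exact (hlim x hx).zero_mul_isBoundedUnder_le (isBoundedUnder_of ⟨C, fun k => hC k x⟩)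
    · simp [hzero _ x hx]

lemma integral_mul_jacobian_insert_piecewise {v u : ι → EuclideanSpace ℝ ι → ℝ}
    (hv : ∀ i, LipschitzWith (K i) (v i)) (hu : ∀ i, LipschitzWith (K i) (u i))
    {ψ : EuclideanSpace ℝ ι → ℝ} {L : ℝ≥0} (hψ : LipschitzWith L ψ) (hψc : HasCompactSupport ψ)
    {i : ι} {S : Finset ι} (hi : i ∉ S) :
    ∫ x, ψ x * jacobian ((insert i S).piecewise v u) x =
      (∫ x, ψ x * jacobian (S.piecewise v u) x) -
        ∫ x, (v i x - u i x) * jacobian (Function.update (S.piecewise v u) i ψ) x := by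
  have hpiece := lipschitzWith_piecewise S hv hu
  have hψi : Integrable ψ := hψ.continuous.integrable_of_hasCompactSupport hψc
  have hsub := (hv i).sub (hu i)
  rw [sub_eq_add_neg, ← integral_mul_jacobian_update hpiece i hψ hψc hsub,
    ← integral_add (integrable_mul_jacobian hpiece hψi)
      (integrable_mul_jacobian (lipschitzWith_update hpiece i hsub) hψi)]
  refine integral_congr_ae ?_
  filter_upwards [(hv i).ae_differentiableAt, (hu i).ae_differentiableAt] with x hvx hux
  have hself : Function.update (S.piecewise v u) i (u i) = S.piecewise v u := by
    rw [Function.update_eq_self_iff, Finset.piecewise_eq_of_notMem _ _ _ hi]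
  rw [Finset.piecewise_insert, jacobian_update_sub hvx hux, hself, ← mul_add,
    add_sub_cancel]

lemma tendsto_integral_mul_jacobian {φ : ℕ → ι → EuclideanSpace ℝ ι → ℝ}
    {u : ι → EuclideanSpace ℝ ι → ℝ} (hφ : ∀ k i, LipschitzWith (K i) (φ k i))
    (hu : ∀ i, LipschitzWith (K i) (u i)) {ψ : EuclideanSpace ℝ ι → ℝ} {L : ℝ≥0}
    (hψ : LipschitzWith L ψ) (hψc : HasCompactSupport ψ)
    (hlim : ∀ i, ∀ x ∈ tsupport ψ, Tendsto (fun k => φ k i x) atTop (𝓝 (u i x))) :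
    Tendsto (fun k => ∫ x, ψ x * jacobian (φ k) x) atTop (𝓝 (∫ x, ψ x * jacobian u x)) := by
  suffices H : ∀ S : Finset ι, Tendsto (fun k => ∫ x, ψ x * jacobian (S.piecewise (φ k) u) x)
      atTop (𝓝 (∫ x, ψ x * jacobian u x)) by
    simpa using H Finset.univ
  intro S
  induction S using Finset.induction_on with
  | empty => simp
  | insert i S hi ih =>
    have hremainder := tendsto_integral_mul_jacobian_update_zero
      (fun k => lipschitzWith_piecewise S (hφ k) hu) i hψ hψc
      (fun k => (hφ k i).sub (hu i)) fun x hx => tendsto_sub_nhds_zero_iff.mpr (hlim i x hx)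
    simpa only [integral_mul_jacobian_insert_piecewise (hφ _) hu hψ hψc hi, sub_zero]
      using ih.sub hremainder

end WeakContinuity

section WeakStarContinuity

variable {E : Type*} [NormedAddCommGroup E] [NormedSpace ℝ E] [FiniteDimensional ℝ E]
  [MeasurableSpace E] [BorelSpace E] {μ : Measure E} [IsFiniteMeasureOnCompacts μ]

lemma exists_cutoff_integral_norm_sub_le {Ω : Set E} (hΩ : IsOpen Ω) {g : E → ℝ}
    (hg : Continuous g) (hgc : HasCompactSupport g) {ε : ℝ} (hε : 0 < ε) :
    ∃ χ : E → ℝ, ContDiff ℝ ∞ χ ∧ HasCompactSupport χ ∧ tsupport χ ⊆ Ω ∧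
      ∫ x in Ω, ‖g x - χ x * g x‖ ∂μ ≤ ε := by
  have : ProperSpace E := FiniteDimensional.proper ℝ E
  obtain ⟨B, hB⟩ := hgc.exists_bound_of_continuous hg
  have hB0 : 0 ≤ B := (norm_nonneg _).trans (hB 0)
  let A := Ω ∩ tsupport g
  have hA : MeasurableSet A := hΩ.measurableSet.inter (isClosed_tsupport g).measurableSet
  have hμA : μ A ≠ ⊤ :=
    measure_ne_top_of_subset Set.inter_subset_right hgc.isCompact.measure_lt_top.ne
  obtain ⟨s, hsA, hs, hμs⟩ := hA.exists_isCompact_sdiff_lt hμA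
    (ENNReal.ofReal_pos.mpr (show 0 < ε / (B + 1) by positivity)).ne'
  obtain ⟨χ, hχ, hχc, hχΩ, hχ1, hχI⟩ :=
    exists_contDiff_cutoff hs hΩ (hsA.trans Set.inter_subset_left)
  refine ⟨χ, hχ, hχc, hχΩ, ?_⟩
  have hsupport : ∀ x ∈ Ω \ (A \ s), ‖g x - χ x * g x‖ = 0 := fun x ⟨hxΩ, hx⟩ => by
    by_cases hxs : x ∈ s
    · simp [hχ1.self_of_nhdsSet x hxs]
    · simp [image_eq_zero_of_notMem_tsupport fun hxg => hx ⟨⟨hxΩ, hxg⟩, hxs⟩]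
  have hbound : ∀ x, ‖g x - χ x * g x‖ ≤ B := fun x => by
    rw [← one_sub_mul, norm_mul, Real.norm_of_nonneg (sub_nonneg.mpr (hχI x).2)]
    exact (mul_le_of_le_one_left (norm_nonneg _) (by linarith [(hχI x).1])).trans (hB x)
  calc ∫ x in Ω, ‖g x - χ x * g x‖ ∂μ = ∫ x in A \ s, ‖g x - χ x * g x‖ ∂μ :=
        setIntegral_eq_of_subset_of_forall_sdiff_eq_zero hΩ.measurableSet
          (Set.sdiff_subset.trans Set.inter_subset_left) hsupport
    _ ≤ B * μ.real (A \ s) := by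
        refine (Real.le_norm_self _).trans (norm_setIntegral_le_of_norm_le_const
          (hμs.trans ENNReal.ofReal_lt_top) fun x _ => ?_)
        rw [norm_norm]
        exact hbound x
    _ ≤ B * (ε / (B + 1)) := by
        gcongr
        exact ENNReal.toReal_le_of_le_ofReal (by positivity) hμs.le
    _ ≤ ε := by
        rw [mul_div_assoc', div_le_iff₀ (by positivity)]
        linarith

lemma exists_contDiff_tsupport_subset_integral_norm_sub_le {Ω : Set E} (hΩ : IsOpen Ω)
    {ψ : E → ℝ} (hψ : IntegrableOn ψ Ω μ) {ε : ℝ} (hε : 0 < ε) :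
    ∃ g : E → ℝ, ContDiff ℝ ∞ g ∧ HasCompactSupport g ∧ tsupport g ⊆ Ω ∧
      ∫ x in Ω, ‖ψ x - g x‖ ∂μ ≤ ε := by
  obtain ⟨g, hgc, hg, hψg⟩ := MemLp.exist_eLpNorm_sub_le (by simp) le_rfl
    (memLp_one_iff_integrable.mpr hψ) (half_pos hε)
  have hgi : IntegrableOn g Ω μ := hg.continuous.integrable_of_hasCompactSupport hgc
  obtain ⟨χ, hχ, hχc, hχΩ, hgχ⟩ :=
    exists_cutoff_integral_norm_sub_le (μ := μ) hΩ hg.continuous hgc (half_pos hε)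
  have hχg : IntegrableOn (fun x => χ x * g x) Ω μ :=
    (hχ.continuous.mul hg.continuous).integrable_of_hasCompactSupport hχc.mul_right
  refine ⟨fun x => χ x * g x, hχ.mul hg, hχc.mul_right, tsupport_mul_subset_left.trans hχΩ, ?_⟩
  calc ∫ x in Ω, ‖ψ x - χ x * g x‖ ∂μ
      ≤ ∫ x in Ω, (‖ψ x - g x‖ + ‖g x - χ x * g x‖) ∂μ :=
        integral_mono (hψ.sub hχg).norm ((hψ.sub hgi).norm.add (hgi.sub hχg).norm)
          fun x => norm_sub_le_norm_sub_add_norm_sub _ _ _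
    _ = (∫ x in Ω, ‖ψ x - g x‖ ∂μ) + ∫ x in Ω, ‖g x - χ x * g x‖ ∂μ :=
        integral_add (hψ.sub hgi).norm (hgi.sub hχg).norm
    _ ≤ ε / 2 + ε / 2 := by
        gcongr
        refine (integral_norm_eq_lintegral_enorm (hψ.sub hgi).aestronglyMeasurable).trans_le ?_
        rw [eLpNorm_one_eq_lintegral_enorm] at hψg
        exact ENNReal.toReal_le_of_le_ofReal (half_pos hε).le hψg
    _ = ε := add_halves ε

lemma lipschitzOnWith_of_tendsto {X Y : Type*} [PseudoMetricSpace X] [PseudoMetricSpace Y]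
    {s : Set X} {K : ℝ≥0} {φ : ℕ → X → Y} {u : X → Y} (hφ : ∀ k, LipschitzOnWith K (φ k) s)
    (hlim : ∀ x ∈ s, Tendsto (fun k => φ k x) atTop (𝓝 (u x))) : LipschitzOnWith K u s :=
  LipschitzOnWith.of_dist_le_mul fun x hx y hy =>
    le_of_tendsto' ((hlim x hx).dist (hlim y hy)) fun k => (hφ k).dist_le_mul x hx y hy

lemma measurable_det_fderiv (F : E → E) : Measurable fun x => (fderiv ℝ F x).det :=
  ContinuousLinearMap.continuous_det.measurable.comp (measurable_fderiv ℝ F)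

lemma tendsto_integral_mul_of_forall_approx {α : Type*} [MeasurableSpace α] {μ : Measure α}
    {J : ℕ → α → ℝ} {J' : α → ℝ} {C : ℝ} (hJm : ∀ k, AEStronglyMeasurable (J k) μ)
    (hJ : ∀ k, ∀ᵐ x ∂μ, |J k x| ≤ C) (hJm' : AEStronglyMeasurable J' μ)
    (hJ' : ∀ᵐ x ∂μ, |J' x| ≤ C) {ψ : α → ℝ} (hψ : Integrable ψ μ)
    (happrox : ∀ ε > 0, ∃ g, Integrable g μ ∧ ∫ x, ‖ψ x - g x‖ ∂μ ≤ ε ∧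
      Tendsto (fun k => ∫ x, g x * J k x ∂μ) atTop (𝓝 (∫ x, g x * J' x ∂μ))) :
    Tendsto (fun k => ∫ x, ψ x * J k x ∂μ) atTop (𝓝 (∫ x, ψ x * J' x ∂μ)) := by
  refine Metric.tendsto_atTop.mpr fun ε hε => ?_
  let C' := max C 0
  have : 0 ≤ C' := le_max_right _ _
  obtain ⟨g, hg, hψg, hlim⟩ := happrox (ε / (3 * (C' + 1))) (by positivity)
  have herror : ∀ f : α → ℝ, AEStronglyMeasurable f μ → (∀ᵐ x ∂μ, |f x| ≤ C) →
      dist (∫ x, ψ x * f x ∂μ) (∫ x, g x * f x ∂μ) ≤ ε / 3 := fun f hfm hf => by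
    rw [dist_eq_norm, ← integral_sub (hψ.mul_bdd hfm hf) (hg.mul_bdd hfm hf)]
    calc ‖∫ x, (ψ x * f x - g x * f x) ∂μ‖ ≤ ∫ x, ‖ψ x - g x‖ * C' ∂μ := by
          refine norm_integral_le_of_norm_le ((hψ.sub hg).norm.mul_const C') ?_
          filter_upwards [hf] with x hx
          rw [← sub_mul, norm_mul]
          gcongr
          exact hx.trans (le_max_left _ _)
      _ ≤ ε / (3 * (C' + 1)) * C' := by rw [integral_mul_const]; gcongr
      _ ≤ ε / 3 := by
          rw [div_mul_eq_mul_div, div_le_div_iff₀ (by positivity) (by positivity)]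
          nlinarith
  obtain ⟨N, hN⟩ := Metric.tendsto_atTop.mp hlim (ε / 3) (by positivity)
  refine ⟨N, fun k hk => ?_⟩
  have hJk := herror _ (hJm k) (hJ k)
  have hJ'g := herror _ hJm' hJ'
  rw [dist_comm] at hJ'g
  linarith [hN k hk, dist_triangle4 (∫ x, ψ x * J k x ∂μ) (∫ x, g x * J k x ∂μ)
    (∫ x, g x * J' x ∂μ) (∫ x, ψ x * J' x ∂μ)]

variable {ι : Type*} [Fintype ι] {Ω : Set (EuclideanSpace ℝ ι)} {K : ℝ≥0}

lemma exists_lipschitzWith_ae_det_fderiv_eq_jacobian [DecidableEq ι] (hΩ : IsOpen Ω)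
    {F : EuclideanSpace ℝ ι → EuclideanSpace ℝ ι} (hF : LipschitzOnWith K F Ω) :
    ∃ f : ι → EuclideanSpace ℝ ι → ℝ, (∀ i, LipschitzWith K (f i)) ∧
      (∀ i, Set.EqOn (fun x => F x i) (f i) Ω) ∧
      ∀ᵐ x ∂volume.restrict Ω, (fderiv ℝ F x).det = jacobian f x := by
  have hext : ∀ i, ∃ f : EuclideanSpace ℝ ι → ℝ, LipschitzWith K f ∧
      Set.EqOn (fun x => F x i) f Ω := fun i => by
    simpa only [one_mul, Function.comp_def] using
      ((lipschitzWith_proj i).comp_lipschitzOnWith hF).extend_real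
  choose f hf hFf using hext
  refine ⟨f, hf, hFf, ?_⟩
  filter_upwards [hF.ae_differentiableWithinAt hΩ.measurableSet,
    ae_restrict_mem hΩ.measurableSet] with x hx hxΩ
  rw [det_fderiv_eq_jacobian (hx.differentiableAt (hΩ.mem_nhds hxΩ))]
  exact jacobian_congr_of_eventuallyEq fun i => (hFf i).eventuallyEq_of_mem (hΩ.mem_nhds hxΩ)

lemma ae_abs_det_fderiv_le (hΩ : IsOpen Ω) {F : EuclideanSpace ℝ ι → EuclideanSpace ℝ ι}
    (hF : LipschitzOnWith K F Ω) : ∀ᵐ x ∂volume.restrict Ω,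
      |(fderiv ℝ F x).det| ≤ (Fintype.card ι).factorial * (K : ℝ) ^ Fintype.card ι := by
  classical
  obtain ⟨f, hf, -, hdet⟩ := exists_lipschitzWith_ae_det_fderiv_eq_jacobian hΩ hF
  filter_upwards [hdet] with x hx
  simpa only [hx, Finset.prod_const, Finset.card_univ] using abs_jacobian_le hf x

lemma integrableOn_det_fderiv (hΩ : IsOpen Ω) (hΩ_fin : volume Ω ≠ ⊤)
    {F : EuclideanSpace ℝ ι → EuclideanSpace ℝ ι} (hF : LipschitzOnWith K F Ω) :
    IntegrableOn (fun x => (fderiv ℝ F x).det) Ω :=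
  .of_bound hΩ_fin.lt_top (measurable_det_fderiv F).aestronglyMeasurable _
    (ae_abs_det_fderiv_le hΩ hF)

theorem tendsto_setIntegral_mul_det_fderiv (hΩ : IsOpen Ω)
    {φ : ℕ → EuclideanSpace ℝ ι → EuclideanSpace ℝ ι}
    {u : EuclideanSpace ℝ ι → EuclideanSpace ℝ ι} (hφ : ∀ k, LipschitzOnWith K (φ k) Ω)
    (hlim : ∀ x ∈ Ω, Tendsto (fun k => φ k x) atTop (𝓝 (u x)))
    {ψ : EuclideanSpace ℝ ι → ℝ} (hψ : IntegrableOn ψ Ω) :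
    Tendsto (fun k => ∫ x in Ω, ψ x * (fderiv ℝ (φ k) x).det) atTop
      (𝓝 (∫ x in Ω, ψ x * (fderiv ℝ u x).det)) := by
  classical
  have hu := lipschitzOnWith_of_tendsto hφ hlim
  refine tendsto_integral_mul_of_forall_approx
    (fun k => (measurable_det_fderiv (φ k)).aestronglyMeasurable)
    (fun k => ae_abs_det_fderiv_le hΩ (hφ k)) (measurable_det_fderiv u).aestronglyMeasurable
    (ae_abs_det_fderiv_le hΩ hu) hψ fun ε hε => ?_
  obtain ⟨g, hg, hgc, hgΩ, hψg⟩ := exists_contDiff_tsupport_subset_integral_norm_sub_le hΩ hψ hε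
  refine ⟨g, hg.continuous.integrable_of_hasCompactSupport hgc, hψg, ?_⟩
  obtain ⟨L, hL⟩ := hg.lipschitzWith_of_hasCompactSupport hgc (by simp)
  choose Φ hΦ hφΦ hΦdet using fun k => exists_lipschitzWith_ae_det_fderiv_eq_jacobian hΩ (hφ k)
  obtain ⟨U, hU, huU, hUdet⟩ := exists_lipschitzWith_ae_det_fderiv_eq_jacobian hΩ hu
  have hset : ∀ {F f}, (∀ᵐ x ∂volume.restrict Ω, (fderiv ℝ F x).det = jacobian f x) →
      ∫ x in Ω, g x * (fderiv ℝ F x).det = ∫ x, g x * jacobian f x := fun {F f} h => by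
    rw [← setIntegral_eq_integral_of_forall_compl_eq_zero (s := Ω) (μ := volume)
      (f := fun x => g x * jacobian f x) fun x hx => by
        rw [image_eq_zero_of_notMem_tsupport fun h => hx (hgΩ h), zero_mul]]
    exact integral_congr_ae (h.mono fun x hx => congrArg (g x * ·) hx)
  rw [hset hUdet]
  simp only [fun k => hset (hΦdet k)]
  refine tendsto_integral_mul_jacobian hΦ hU hL hgc fun i x hx => ?_
  simpa only [← hφΦ _ i (hgΩ hx), ← huU i (hgΩ hx), Function.comp_def] using
    ((lipschitzWith_proj i).continuous.tendsto _).comp (hlim x (hgΩ hx))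

end WeakStarContinuity

section LowerSemicontinuity

variable {α : Type*} [MeasurableSpace α] {μ : Measure α}

lemma extIntegral_mono {f g : α → ℝ} (hfg : f ≤ᵐ[μ] g) : extIntegral μ f ≤ extIntegral μ g := by
  refine EReal.sub_le_sub ?_ ?_ <;>
    refine EReal.coe_ennreal_le_coe_ennreal_iff.mpr (lintegral_mono_ae ?_)
  · filter_upwards [hfg] with x hx using ENNReal.ofReal_le_ofReal hx
  · filter_upwards [hfg] with x hx using ENNReal.ofReal_le_ofReal (neg_le_neg hx)

lemma extIntegral_congr {f g : α → ℝ} (hfg : f =ᵐ[μ] g) : extIntegral μ f = extIntegral μ g :=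
  (extIntegral_mono hfg.le).antisymm (extIntegral_mono hfg.symm.le)

lemma extIntegral_eq_integral {f : α → ℝ} (hf : Integrable f μ) :
    extIntegral μ f = ((∫ x, f x ∂μ : ℝ) : EReal) := by
  have hneg : ∫⁻ x, ENNReal.ofReal (-f x) ∂μ ≠ ⊤ := hf.neg.lintegral_lt_top.ne
  rw [integral_eq_lintegral_pos_part_sub_lintegral_neg_part hf, EReal.coe_sub, extIntegral,
    EReal.coe_ennreal_toReal hf.lintegral_lt_top.ne, EReal.coe_ennreal_toReal hneg]

lemma lintegral_ofReal_neg_lt_top {f g : α → ℝ} (hf : Integrable f μ) (hfg : f ≤ᵐ[μ] g) :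
    ∫⁻ x, ENNReal.ofReal (-g x) ∂μ < ⊤ := by
  refine (lintegral_mono_ae ?_).trans_lt hf.neg.lintegral_lt_top
  filter_upwards [hfg] with x hx using ENNReal.ofReal_le_ofReal (neg_le_neg hx)

lemma ae_nonneg_of_tendsto_integral_mul {f : ℕ → α → ℝ} {f' : α → ℝ}
    (hf : ∀ k, 0 ≤ᵐ[μ] f k) (hf' : Integrable f' μ)
    (hlim : ∀ ψ : α → ℝ, Integrable ψ μ →
      Tendsto (fun k => ∫ x, ψ x * f k x ∂μ) atTop (𝓝 (∫ x, ψ x * f' x ∂μ))) :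
    0 ≤ᵐ[μ] f' := by
  refine ae_nonneg_of_forall_setIntegral_nonneg hf' fun s hs hμs => ?_
  have hindicator : ∀ g : α → ℝ, ∫ x, s.indicator 1 x * g x ∂μ = ∫ x in s, g x ∂μ := fun g => by
    simp only [← integral_indicator hs, ← Set.indicator_mul_left, Pi.one_apply, one_mul]
  have htendsto := hlim (s.indicator 1) ((integrable_indicator_iff hs).mpr
    (integrableOn_const hμs.ne))
  simp only [hindicator] at htendsto
  exact ge_of_tendsto' htendsto fun k => integral_nonneg_of_ae (ae_restrict_of_ae (hf k))

lemma add_rightDeriv_mul_sub_le {G : ℝ → ℝ} {s : Set ℝ} (hG : ConvexOn ℝ s G) {t r : ℝ}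
    (ht : t ∈ interior s) (hr : r ∈ s) :
    G t + derivWithin G (Set.Ioi t) t * (r - t) ≤ G r := by
  rcases lt_trichotomy r t with hrt | rfl | htr
  · have hslope := (hG.slope_le_leftDeriv_of_mem_interior hr ht hrt).trans
      (hG.leftDeriv_le_rightDeriv_of_mem_interior ht)
    rw [slope_def_field, div_le_iff₀ (sub_pos.mpr hrt)] at hslope
    linarith
  · simp
  · have hslope := hG.rightDeriv_le_slope_of_mem_interior ht hr htr
    rw [slope_def_field, le_div_iff₀ (sub_pos.mpr htr)] at hslope
    linarith

lemma aemeasurable_comp_of_continuousOn {G : ℝ → ℝ} {s : Set ℝ} (hs : MeasurableSet s)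
    (hG : ContinuousOn G s) {f : α → ℝ} (hf : AEMeasurable f μ) (hfs : ∀ᵐ x ∂μ, f x ∈ s) :
    AEMeasurable (fun x => G (f x)) μ := by
  refine AEMeasurable.comp_aemeasurable (g := G) ?_ hf
  rw [← Measure.restrict_eq_self_of_ae_mem ((ae_map_iff hf hs).mpr hfs)]
  exact hG.aemeasurable hs

lemma integrable_comp_of_continuousOn [IsFiniteMeasure μ] {G : ℝ → ℝ} {s : Set ℝ}
    (hs : IsCompact s) (hG : ContinuousOn G s) {f : α → ℝ} (hf : AEMeasurable f μ)
    (hfs : ∀ᵐ x ∂μ, f x ∈ s) : Integrable (fun x => G (f x)) μ := by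
  obtain ⟨C, hC⟩ := hs.exists_bound_of_continuousOn hG
  exact .of_bound
    (aemeasurable_comp_of_continuousOn hs.measurableSet hG hf hfs).aestronglyMeasurable C
    (hfs.mono fun x hx => hC _ hx)

variable {G : ℝ → ℝ} {s : Set ℝ}

lemma lintegral_ofReal_neg_comp_lt_top [IsFiniteMeasure μ] (hG : ConvexOn ℝ s G) {t : ℝ}
    (ht : t ∈ interior s) {f : α → ℝ} (hf : Integrable f μ) (hfs : ∀ᵐ x ∂μ, f x ∈ s) :
    ∫⁻ x, ENNReal.ofReal (-G (f x)) ∂μ < ⊤ :=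
  lintegral_ofReal_neg_lt_top
    ((integrable_const (G t)).add ((hf.sub (integrable_const t)).const_mul _))
    (hfs.mono fun _ hx => add_rightDeriv_mul_sub_le hG ht hx)

lemma exists_abs_rightDeriv_le (hG : ConvexOn ℝ s G) {a b : ℝ}
    (hab : Set.Icc a b ⊆ interior s) :
    ∃ C, ∀ t ∈ Set.Icc a b, |derivWithin G (Set.Ioi t) t| ≤ C := by
  refine ⟨max |derivWithin G (Set.Ioi a) a| |derivWithin G (Set.Ioi b) b|, fun t ht => ?_⟩
  have hle := ht.1.trans ht.2
  exact abs_le_max_abs_abs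
    (hG.monotoneOn_rightDeriv (hab (Set.left_mem_Icc.mpr hle)) (hab ht) ht.1)
    (hG.monotoneOn_rightDeriv (hab ht) (hab (Set.right_mem_Icc.mpr hle)) ht.2)

theorem extIntegral_comp_le_liminf [IsFiniteMeasure μ] (hG : ConvexOn ℝ s G) {a b : ℝ}
    (hab : Set.Icc a b ⊆ interior s) {f : ℕ → α → ℝ} {f' : α → ℝ}
    (hf : ∀ k, Integrable (f k) μ) (hfs : ∀ k, ∀ᵐ x ∂μ, f k x ∈ s)
    (hf' : Integrable f' μ) (hf'ab : ∀ᵐ x ∂μ, f' x ∈ Set.Icc a b)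
    (hlim : ∀ ψ : α → ℝ, Integrable ψ μ →
      Tendsto (fun k => ∫ x, ψ x * f k x ∂μ) atTop (𝓝 (∫ x, ψ x * f' x ∂μ))) :
    extIntegral μ (fun x => G (f' x)) ≤
      liminf (fun k => extIntegral μ (fun x => G (f k x))) atTop := by
  let q : α → ℝ := fun x => derivWithin G (Set.Ioi (f' x)) (f' x)
  obtain ⟨C, hC⟩ := exists_abs_rightDeriv_le hG hab
  have hqm : AEStronglyMeasurable q μ :=
    ((measurable_derivWithin_Ioi G).comp_aemeasurable hf'.aemeasurable).aestronglyMeasurable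
  have hqC : ∀ᵐ x ∂μ, ‖q x‖ ≤ C := hf'ab.mono fun x hx => hC _ hx
  have hGf' : Integrable (fun x => G (f' x)) μ := integrable_comp_of_continuousOn isCompact_Icc
    (hG.continuousOn_interior.mono hab) hf'.aemeasurable hf'ab
  have hqf : ∀ {g : α → ℝ}, Integrable g μ → Integrable (fun x => q x * g x) μ :=
    fun hg => hg.bdd_mul hqm hqC
  let r : ℕ → α → ℝ := fun k x => G (f' x) + (q x * f k x - q x * f' x)
  have hr : ∀ k, Integrable (r k) μ := fun k => hGf'.add ((hqf (hf k)).sub (hqf hf'))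
  have hrle : ∀ k, r k ≤ᵐ[μ] fun x => G (f k x) := fun k => by
    filter_upwards [hfs k, hf'ab] with x hx hx'
    simpa only [r, ← mul_sub] using add_rightDeriv_mul_sub_le hG (hab hx') hx
  have hrlim : Tendsto (fun k => ∫ x, r k x ∂μ) atTop (𝓝 (∫ x, G (f' x) ∂μ)) := by
    have hr_eq : ∀ k, ∫ x, r k x ∂μ = (∫ x, G (f' x) ∂μ) +
        ((∫ x, q x * f k x ∂μ) - ∫ x, q x * f' x ∂μ) := fun k => by
      rw [← integral_sub (hqf (hf k)) (hqf hf')]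
      exact integral_add hGf' ((hqf (hf k)).sub (hqf hf'))
    simp only [hr_eq]
    simpa only [sub_self, add_zero] using
      ((hlim q (.of_bound hqm C hqC)).sub_const
        (∫ x, q x * f' x ∂μ)).const_add (∫ x, G (f' x) ∂μ)
  rw [extIntegral_eq_integral hGf', ← ((continuous_coe_real_ereal.tendsto _).comp hrlim).liminf_eq]
  refine liminf_le_liminf (Eventually.of_forall fun k => ?_)
  rw [Function.comp_apply, ← extIntegral_eq_integral (hr k)]
  exact extIntegral_mono (hrle k)

end LowerSemicontinuity

lemma exists_ae_det_fderiv_mem_Icc {ι : Type*} [Fintype ι] {Ω : Set (EuclideanSpace ℝ ι)}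
    (hΩ : IsOpen Ω) (hΩ_fin : volume Ω ≠ ⊤) {K : ℝ≥0}
    {φ : ℕ → EuclideanSpace ℝ ι → EuclideanSpace ℝ ι}
    {u : EuclideanSpace ℝ ι → EuclideanSpace ℝ ι} (hφ : ∀ k, LipschitzOnWith K (φ k) Ω)
    (hlim : ∀ x ∈ Ω, Tendsto (fun k => φ k x) atTop (𝓝 (u x)))
    (hφ_det : ∀ k, ∀ᵐ x ∂volume.restrict Ω, 0 ≤ (fderiv ℝ (φ k) x).det) {c : ℝ}
    (hu_det : ∀ᵐ x ∂volume.restrict Ω, c ≤ |(fderiv ℝ u x).det|) :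
    ∃ C, ∀ᵐ x ∂volume.restrict Ω, (fderiv ℝ u x).det ∈ Set.Icc c C := by
  have hu := lipschitzOnWith_of_tendsto hφ hlim
  have hnonneg := ae_nonneg_of_tendsto_integral_mul hφ_det (integrableOn_det_fderiv hΩ hΩ_fin hu)
    fun ψ hψ => tendsto_setIntegral_mul_det_fderiv hΩ hφ hlim hψ
  refine ⟨(Fintype.card ι).factorial * (K : ℝ) ^ Fintype.card ι, ?_⟩
  filter_upwards [hu_det, ae_abs_det_fderiv_le hΩ hu, hnonneg] with x hcx hxC hx
  rw [abs_of_nonneg hx] at hcx hxC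
  exact ⟨hcx, hxC⟩

section BiLipschitz

lemma norm_le_mul_norm_fderiv {E F : Type*} [NormedAddCommGroup E] [NormedSpace ℝ E]
    [NormedAddCommGroup F] [NormedSpace ℝ F] {u : E → F} {x : E} {C : ℝ}
    (hd : DifferentiableAt ℝ u x) (hu : ∀ᶠ y in 𝓝 x, dist y x ≤ C * dist (u y) (u x)) (v : E) :
    ‖v‖ ≤ C * ‖fderiv ℝ u x v‖ := by
  have hslope := (hd.hasFDerivAt.hasLineDerivAt v).tendsto_slope_zero
  have hline : Tendsto (fun t : ℝ => x + t • v) (𝓝[≠] 0) (𝓝 x) :=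
    (Continuous.tendsto' (by fun_prop) _ _ (by simp)).mono_left nhdsWithin_le_nhds
  refine ge_of_tendsto (hslope.norm.const_mul C) ?_
  filter_upwards [hline.eventually hu, self_mem_nhdsWithin] with t ht ht0
  have ht0 : 0 < ‖t‖ := norm_pos_iff.mpr ht0
  rw [dist_eq_norm, dist_eq_norm, add_sub_cancel_left, norm_smul] at ht
  rwa [norm_smul, norm_inv, mul_left_comm, ← div_eq_inv_mul, le_div_iff₀ ht0, mul_comm]

lemma one_le_pow_mul_abs_det {E : Type*} [NormedAddCommGroup E] [NormedSpace ℝ E]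
    [FiniteDimensional ℝ E] {A : E →L[ℝ] E} {K : ℝ≥0} (hA : AntilipschitzWith K A) :
    1 ≤ (K : ℝ) ^ Module.finrank ℝ E * |A.det| := by
  borelize E
  have hball := hA.le_hausdorffMeasure_image (Nat.cast_nonneg (Module.finrank ℝ E))
    (Metric.ball 0 1)
  rw [Measure.addHaar_image_continuousLinearMap, ← mul_assoc, ENNReal.rpow_natCast] at hball
  have hone : 1 ≤ (K : ℝ≥0∞) ^ Module.finrank ℝ E * ENNReal.ofReal |A.det| := by
    have hpos := Metric.measure_ball_pos μH[Module.finrank ℝ E] (0 : E) one_pos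
    rwa [← ENNReal.mul_le_mul_iff_left hpos.ne' measure_ball_lt_top.ne, one_mul]
  simpa using ENNReal.toReal_mono (by finiteness) hone

lemma exists_pos_forall_ae_le_abs_det_fderiv {n : ℕ} {Ω : Set (EuclideanSpace ℝ (Fin n))}
    (hΩ : IsOpen Ω) {u : EuclideanSpace ℝ (Fin n) → EuclideanSpace ℝ (Fin n)}
    (hu : IsBiLipschitzOn u Ω) :
    ∃ c > 0, ∀ᵐ x ∂volume.restrict Ω, c ≤ |(fderiv ℝ u x).det| := by
  obtain ⟨⟨L, hL⟩, K, hK⟩ := hu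
  refine ⟨((K : ℝ) ^ n + 1)⁻¹, by positivity, ?_⟩
  filter_upwards [hL.ae_differentiableWithinAt hΩ.measurableSet,
    ae_restrict_mem hΩ.measurableSet] with x hd hx
  have hΩx := hΩ.mem_nhds hx
  have hA : AntilipschitzWith K (fderiv ℝ u x) :=
    (fderiv ℝ u x).antilipschitz_of_bound (norm_le_mul_norm_fderiv (hd.differentiableAt hΩx)
      (by filter_upwards [hΩx] with y hy using hK y hy x hx))
  have hdet := one_le_pow_mul_abs_det hA
  rw [finrank_euclideanSpace_fin] at hdet
  rw [inv_le_iff_one_le_mul₀' (by positivity)]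
  linarith [abs_nonneg (fderiv ℝ u x).det]

end BiLipschitz

end GLLsc

theorem proposition6p1_general (n : ℕ)
    (g : (Fin n → ℝ) → ℝ)
    (h : (Fin n → ℝ) → ℝ)
    (hh : ∀ x, h x = g (fun i => Real.exp (x i)))
    (hh_convex : ConvexOn ℝ Set.univ h)
    (p : (Fin n → ℝ) → ℝ)
    (hp : GLLsc.IsAssociated p h)
    (hp_mono : GLLsc.NonincreasingInEachArgumentOn p (Set.range GLLsc.decreasingPartialSums))
    (Ω : Set (EuclideanSpace ℝ (Fin n)))
    (hΩ_open : IsOpen Ω) (hΩ_fin : volume Ω ≠ ⊤)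
    (φ : ℕ → EuclideanSpace ℝ (Fin n) → EuclideanSpace ℝ (Fin n))
    (hφ_lip : ∃ K : ℝ≥0, ∀ k, LipschitzOnWith K (φ k) Ω)
    (hφ_det : ∀ k, ∀ᵐ x ∂(volume.restrict Ω), fderiv ℝ (φ k) x ∈ GLLsc.glPos n)
    (u : EuclideanSpace ℝ (Fin n) → EuclideanSpace ℝ (Fin n))
    (hu_det : ∃ c > 0, ∀ᵐ x ∂(volume.restrict Ω), c ≤ |(fderiv ℝ u x).det|)
    (hφu : ∀ x ∈ Ω, Tendsto (fun k => φ k x) atTop (𝓝 (u x))) :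
    (∀ᵐ x ∂(volume.restrict Ω), fderiv ℝ u x ∈ GLLsc.glPos n) ∧
    IntegrableOn (fun x => GLLsc.isotropicPotential g (fderiv ℝ u x)) Ω volume ∧
    (∀ k, AEMeasurable (fun x => GLLsc.isotropicPotential g (fderiv ℝ (φ k) x))
        (volume.restrict Ω) ∧
      ∫⁻ x, ENNReal.ofReal (-GLLsc.isotropicPotential g (fderiv ℝ (φ k) x))
        ∂(volume.restrict Ω) < ⊤) ∧
    GLLsc.extIntegral (volume.restrict Ω)
        (fun x => GLLsc.isotropicPotential g (fderiv ℝ u x)) ≤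
      liminf (fun k => GLLsc.extIntegral (volume.restrict Ω)
        (fun x => GLLsc.isotropicPotential g (fderiv ℝ (φ k) x))) atTop := by
  have : IsFiniteMeasure (volume.restrict Ω) := isFiniteMeasure_restrict.mpr hΩ_fin
  obtain ⟨G, hG, hw⟩ := GLLsc.exists_convexOn_isotropicPotential_eq hh hh_convex hp hp_mono
  obtain ⟨K, hφ⟩ := hφ_lip
  obtain ⟨c, hc, hu_det⟩ := hu_det
  have hweak := fun ψ hψ => GLLsc.tendsto_setIntegral_mul_det_fderiv hΩ_open hφ hφu (ψ := ψ) hψ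
  have hφi := fun k => GLLsc.integrableOn_det_fderiv hΩ_open hΩ_fin (hφ k)
  have hui := GLLsc.integrableOn_det_fderiv hΩ_open hΩ_fin
    (GLLsc.lipschitzOnWith_of_tendsto hφ hφu)
  have hφw : ∀ k, _ =ᵐ[volume.restrict Ω] _ := fun k => (hφ_det k).mono fun x hx => hw _ hx
  obtain ⟨C, hC⟩ := GLLsc.exists_ae_det_fderiv_mem_Icc hΩ_open hΩ_fin hφ hφu
    (fun k => (hφ_det k).mono fun x hx => hx.le) hu_det
  have hcC : Set.Icc c C ⊆ Set.Ioi 0 := fun t ht => hc.trans_le ht.1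
  have hu_pos : ∀ᵐ x ∂(volume.restrict Ω), fderiv ℝ u x ∈ GLLsc.glPos n :=
    hC.mono fun x hx => hcC hx
  have huw : _ =ᵐ[volume.restrict Ω] _ := hu_pos.mono fun x hx => hw _ hx
  refine ⟨hu_pos, ?_, fun k => ⟨?_, ?_⟩, ?_⟩
  · exact (GLLsc.integrable_comp_of_continuousOn isCompact_Icc
      ((hG.continuousOn isOpen_Ioi).mono hcC) hui.aemeasurable hC).congr huw.symm
  · exact (GLLsc.aemeasurable_comp_of_continuousOn measurableSet_Ioi (hG.continuousOn isOpen_Ioi)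
      (hφi k).aemeasurable (hφ_det k)).congr (hφw k).symm
  · rw [lintegral_congr_ae ((hφw k).mono fun x hx => congrArg (fun t => ENNReal.ofReal (-t)) hx)]
    exact GLLsc.lintegral_ofReal_neg_comp_lt_top hG (t := 1) (by simp) (hφi k) (hφ_det k)
  · rw [GLLsc.extIntegral_congr huw]
    simp only [fun k => GLLsc.extIntegral_congr (hφw k)]
    exact GLLsc.extIntegral_comp_le_liminf hG (by simpa using hcC) hφi hφ_det hui hC hweak

theorem proposition6p1 (n : ℕ)
    (g : (Fin n → ℝ) → ℝ)
    (hg_cont : ContinuousOn g {s | ∀ i, 0 < s i})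
    (hg_symm : ∀ s : Fin n → ℝ, (∀ i, 0 < s i) → ∀ π : Equiv.Perm (Fin n), g (s ∘ π) = g s)
    (h : (Fin n → ℝ) → ℝ)
    (hh : ∀ x, h x = g (fun i => Real.exp (x i)))
    (hh_convex : ConvexOn ℝ Set.univ h)
    (p : (Fin n → ℝ) → ℝ)
    (hp : GLLsc.IsAssociated p h)
    (hp_mono : GLLsc.NonincreasingInEachArgumentOn p (Set.range GLLsc.decreasingPartialSums))
    (Ω : Set (EuclideanSpace ℝ (Fin n)))
    (hΩ_open : IsOpen Ω) (hΩ_bdd : Bornology.IsBounded Ω)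
    (φ : ℕ → EuclideanSpace ℝ (Fin n) → EuclideanSpace ℝ (Fin n))
    (hφ_lip : ∃ K : ℝ≥0, ∀ k, LipschitzOnWith K (φ k) Ω)
    (hφ_det : ∀ k, ∀ᵐ x ∂(volume.restrict Ω), fderiv ℝ (φ k) x ∈ GLLsc.glPos n)
    (u : EuclideanSpace ℝ (Fin n) → EuclideanSpace ℝ (Fin n))
    (hu : GLLsc.IsBiLipschitzOn u Ω)
    (hφu : TendstoUniformlyOn φ u atTop Ω) :
    -- `Du ∈ GL(n, ℝ)⁺` a.e. in `Ω`, and both sides of the inequality are well defined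
    (∀ᵐ x ∂(volume.restrict Ω), fderiv ℝ u x ∈ GLLsc.glPos n) ∧
    IntegrableOn (fun x => GLLsc.isotropicPotential g (fderiv ℝ u x)) Ω volume ∧
    (∀ k, AEMeasurable (fun x => GLLsc.isotropicPotential g (fderiv ℝ (φ k) x))
        (volume.restrict Ω) ∧
      ∫⁻ x, ENNReal.ofReal (-GLLsc.isotropicPotential g (fderiv ℝ (φ k) x))
        ∂(volume.restrict Ω) < ⊤) ∧
    -- the lower semicontinuity inequality
    GLLsc.extIntegral (volume.restrict Ω)
        (fun x => GLLsc.isotropicPotential g (fderiv ℝ u x)) ≤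
      liminf (fun k => GLLsc.extIntegral (volume.restrict Ω)
        (fun x => GLLsc.isotropicPotential g (fderiv ℝ (φ k) x))) atTop := by
  exact proposition6p1_general n g h hh hh_convex p hp hp_mono Ω hΩ_open hΩ_bdd.measure_lt_top.ne
    φ hφ_lip hφ_det u (GLLsc.exists_pos_forall_ae_le_abs_det_fderiv hΩ_open hu)
    fun _ hx => hφu.tendsto_at hx
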